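/- Let $F=\mathbb F_q$ be a finite field of order $q=3^m$, let $L=\mathbb F_{q^n}$ be an extension of $F$ of degree $n\ge 1$, and let $a\in F$, $a\neq 0$. Put $\omega=e^{2\pi i/3}$, let $\mathrm{Tr}:F\to\mathbb F_3$ be the absolute trace and $\mathrm{Tr}_{L\to F}:L\to F$ the relative trace, and define the Kloosterman sums (with the convention $a/0=0$) $$K(a)=\sum_{x\in F}\omega^{\mathrm{Tr}(x+a/x)},\qquad K_n(a)=\sum_{x\in L}\omega^{\mathrm{Tr}(\mathrm{Tr}_{L\to F}(x+a/x))},$$ which are rational integers. Let $H(a)$ be the largest $k$ such that $3^k$ divides $K(a)$, with $H(a)=m$ if $K(a)=0$; likewise let $H_n(a)$ be the largest $k$ such that $3^k$ divides $K_n(a)$, with $H_n(a)=mn$ if $K_n(a)=0$. If $n$ is coprime to $3$, then $$H_n(a)=H(a).$$ -/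

import Mathlib

namespace TernaryKloosterman

/-- The primitive cube root of unity `ω = exp (2πi/3)`. -/
noncomputable def omega : ℂ := Complex.exp (2 * Real.pi * Complex.I / 3)

/-- `ω ^ t` for a residue class `t` modulo `3`. -/
noncomputable def omegaPow (t : ZMod 3) : ℂ := omega ^ t.val

/-- The additive character `e(x) = ω ^ Tr(x)` of a finite field `F` of characteristic `3`, where
`Tr` is the absolute trace `F → 𝔽₃`. -/
noncomputable def e (F : Type*) [Field F] [Algebra (ZMod 3) F] (x : F) : ℂ :=
  omegaPow (Algebra.trace (ZMod 3) F x)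

/-- The additive character `e_n(y) = ω ^ Tr(Tr_{L → F}(y))` of an extension `L` of `F`. -/
noncomputable def eExt (F L : Type*) [Field F] [Algebra (ZMod 3) F] [Field L] [Algebra F L]
    (y : L) : ℂ :=
  omegaPow (Algebra.trace (ZMod 3) F (Algebra.trace F L y))

/-- The Kloosterman sum `K(a) = ∑_{x ∈ F} e(x + a/x)`, with `a/0 = 0`. -/
noncomputable def kloosterman (F : Type*) [Field F] [Fintype F] [Algebra (ZMod 3) F]
    (a : F) : ℂ :=
  ∑ x : F, e F (x + a / x)

/-- The Kloosterman sum `K_n(a) = ∑_{x ∈ L} e_n(x + a/x)` over an extension `L` of `F`, for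
`a ∈ F`, with `a/0 = 0`. -/
noncomputable def kloostermanExt (F L : Type*) [Field F] [Algebra (ZMod 3) F]
    [Field L] [Fintype L] [Algebra F L] (a : F) : ℂ :=
  ∑ x : L, eExt F L (x + algebraMap F L a / x)

/-- The largest `k` such that `3 ^ k` divides `K` (as a rational integer), with the convention
that this is `N` when `K = 0`. -/
noncomputable def maxDegThree (N : ℕ) (K : ℂ) : ℕ :=
  open Classical in
  if K = 0 then N else sSup {k : ℕ | ∃ z : ℤ, K = (3 : ℂ) ^ k * z}

/-- `H(a)`: the exponent of the exact power of `3` dividing `K(a)`; it is `m` if `K(a) = 0`,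
where `|F| = 3 ^ m`. -/
noncomputable def H (F : Type*) [Field F] [Fintype F] [Algebra (ZMod 3) F] (a : F) : ℕ :=
  maxDegThree (Module.finrank (ZMod 3) F) (kloosterman F a)

/-- `H_n(a)`: the exponent of the exact power of `3` dividing `K_n(a)`; it is `m * n` if
`K_n(a) = 0`, where `|L| = 3 ^ (m * n)`. -/
noncomputable def HExt (F L : Type*) [Field F] [Algebra (ZMod 3) F]
    [Field L] [Fintype L] [Algebra F L] (a : F) : ℕ :=
  maxDegThree (Module.finrank (ZMod 3) F * Module.finrank F L) (kloostermanExt F L a)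

/-! The sums are rational integers and the maximum is attained, so `H` and `HExt` are
well defined. -/

theorem one_add_omega_add_sq : 1 + omega + omega ^ 2 = 0 := by
  have h : IsPrimitiveRoot omega 3 := by
    simpa [omega] using Complex.isPrimitiveRoot_exp 3 (by norm_num)
  have := h.geom_sum_eq_zero (by norm_num)
  simpa [Finset.sum_range_succ] using this

theorem sum_omegaPow_isInt {X : Type*} [AddGroup X] [Fintype X] (f : X → ZMod 3)
    (hf : ∀ x, f (-x) = -f x) : ∃ k : ℤ, ∑ x, omegaPow (f x) = k := by
  let α : ZMod 3 → ℤ := fun t => if t = 0 then 1 else if t = 1 then 0 else -1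
  let β : ZMod 3 → ℤ := fun t => if t = 0 then 0 else if t = 1 then 1 else -1
  have hβ : ∀ t, β (-t) = -β t := by decide
  have hpow : ∀ t, omegaPow t = (α t : ℂ) + omega * (β t : ℂ) := by
    intro t
    have h2 : omega ^ 2 = -1 - omega := by linear_combination one_add_omega_add_sq
    have ht : t = 0 ∨ t = 1 ∨ t = 2 := by revert t; decide
    rcases ht with rfl | rfl | rfl
    · simp [omegaPow, α, β]
    · simp [omegaPow, α, β, ZMod.val_one]
    · have hv : (2 : ZMod 3).val = 2 := rfl
      have h20 : (2 : ZMod 3) ≠ 0 := by decide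
      have h21 : (2 : ZMod 3) ≠ 1 := by decide
      simp only [omegaPow, α, β, hv, h2, h20, h21, if_false]
      push_cast
      ring
  have hs : ∑ x, β (f x) = 0 := by
    have h : ∑ x, β (f x) = -∑ x, β (f x) := by
      rw [← Finset.sum_neg_distrib, ← Equiv.sum_comp (Equiv.neg X)]
      simp [hf, hβ]
    omega
  refine ⟨∑ x, α (f x), ?_⟩
  simp_rw [hpow]
  rw [Finset.sum_add_distrib, ← Finset.mul_sum, ← Int.cast_sum, ← Int.cast_sum, hs]
  simp

theorem kloosterman_isInt (F : Type*) [Field F] [Fintype F] [Algebra (ZMod 3) F] (a : F) :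
    ∃ k : ℤ, kloosterman F a = k :=
  sum_omegaPow_isInt (fun x : F => Algebra.trace (ZMod 3) F (x + a / x)) fun x => by
    rw [div_neg, ← neg_add, map_neg]

theorem kloostermanExt_isInt (F L : Type*) [Field F] [Algebra (ZMod 3) F]
    [Field L] [Fintype L] [Algebra F L] (a : F) :
    ∃ k : ℤ, kloostermanExt F L a = k :=
  sum_omegaPow_isInt
    (fun x : L => Algebra.trace (ZMod 3) F (Algebra.trace F L (x + algebraMap F L a / x)))
    fun x => by rw [div_neg, ← neg_add, map_neg, map_neg]

theorem maxDegThree_intCast (N : ℕ) (k : ℤ) :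
    maxDegThree N (k : ℂ) = if k = 0 then N else padicValInt 3 k := by
  unfold maxDegThree
  by_cases hk : k = 0
  · simp [hk]
  · rw [if_neg (by exact_mod_cast hk), if_neg hk]
    have : {j : ℕ | ∃ z : ℤ, (k : ℂ) = (3 : ℂ) ^ j * z} = Set.Iic (padicValInt 3 k) := by
      ext j
      have h := padicValInt_dvd_iff (p := 3) j k
      simp only [hk, false_or] at h
      rw [Set.mem_Iic, ← h]
      constructor
      · rintro ⟨z, hz⟩
        exact ⟨z, by exact_mod_cast hz⟩
      · rintro ⟨z, hz⟩
        exact ⟨z, by exact_mod_cast hz⟩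
    rw [this]
    exact csSup_Iic

end TernaryKloosterman

/-!
Write `q = 3 ^ m`. The sum over `x ≠ 0` has an `L`-function which is the polynomial
`1 + (K - 1) T + q T ^ 2`, so that `K = 1 - α - β` and `K_n = 1 - α ^ n - β ^ n` with `α β = q`.
Therefore `K + q = (1 - α) (1 - β)`, and `K_n + q ^ n = (1 - α ^ n) (1 - β ^ n)` is the product of
`K + q` and an integer which modulo `3`, where `{α, β} = {1, 0}`, is `n`. So `K + q` and
`K_n + q ^ n` have the same `3`-adic valuation (`exists_cofactor`, where `α` and `β` enter only
through the companion matrix of their polynomial).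

To remove the summands `q` and `q ^ n`, let `N` be the number of zeros of `Tr (x + a / x)`. Pairing
`x` with `-x` gives `2 K = 3 N - q` with `1 ≤ N ≤ q` (`two_mul_kloosterman`), hence `3 ∣ K` and
`-q < K ≤ q`. If `K` is neither `0` nor `q`, its valuation is less than `m` and adding multiples of
`3 ^ m` does not change it; if `K` is `0` or `q`, then `K + q` has valuation `m < m n`, for
`n ≥ 2`, which is also the value assigned to `K` (`valuation_eq_of_cofactor`).

The `L`-function is treated through coefficients. `kloostermanWeight` is completely multiplicative
on monic polynomials over `F`, and its sums over degrees `0, 1, 2` are `1`, `K - 1`, `q`, and `0`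
from degree `3` on. Unique factorization expresses these sums through weighted power sums over the
prime polynomials (`natCast_mul_sum_monics`, the logarithmic derivative of the Euler product), and
grouping the elements of `L` by minimal polynomial identifies the `n`-th power sum with `K_n - 1`
(`primePowerSum_kloostermanWeight_finrank`).
-/

namespace TernaryKloosterman

open Polynomial Finset

/-! ### Power sums of a quadratic polynomial and powers of three -/

theorem trace_pow_add_two {R : Type*} [CommRing R] (M : Matrix (Fin 2) (Fin 2) R) (n : ℕ) :
    (M ^ (n + 2)).trace = M.trace * (M ^ (n + 1)).trace - M.det * (M ^ n).trace := by
  have h : M ^ 2 = M.trace • M - M.det • (1 : Matrix (Fin 2) (Fin 2) R) := by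
    ext i j
    fin_cases i <;> fin_cases j <;>
      simp [pow_two, Matrix.mul_apply, Fin.sum_univ_two, Matrix.trace, Matrix.det_fin_two] <;> ring
  rw [pow_add, h, mul_sub, Matrix.mul_smul, Matrix.mul_smul, mul_one, ← pow_succ,
    Matrix.trace_sub, Matrix.trace_smul, Matrix.trace_smul, smul_eq_mul, smul_eq_mul]

theorem det_one_sub_fin_two {R : Type*} [CommRing R] (M : Matrix (Fin 2) (Fin 2) R) :
    (1 - M).det = 1 - M.trace + M.det := by
  simp [Matrix.det_fin_two, Matrix.trace, Fin.sum_univ_two]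
  ring

/-- The companion matrix of `X ^ 2 - t X + q`; the traces of its powers are the power sums of the
roots of this polynomial. -/
def companion {R : Type*} [CommRing R] (t q : R) : Matrix (Fin 2) (Fin 2) R := !![0, -q; 1, t]

theorem trace_companion {R : Type*} [CommRing R] (t q : R) : (companion t q).trace = t := by
  simp [companion, Matrix.trace, Fin.sum_univ_two]

theorem det_companion {R : Type*} [CommRing R] (t q : R) : (companion t q).det = q := by
  simp [companion, Matrix.det_fin_two]

/-- With `α + β = t` and `α β = q`, this is the factorization
`(1 - α ^ n) (1 - β ^ n) = (1 - α) (1 - β) ∑ α ^ i ∑ β ^ j`; modulo `3` the pair `{α, β}` is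
`{1, 0}`, so that the cofactor is congruent to `n`. -/
theorem exists_cofactor {q t : ℤ} (hq : (3 : ℤ) ∣ q) (ht : (3 : ℤ) ∣ 1 - t)
    {n : ℕ} (hn0 : n ≠ 0) (hn : n.Coprime 3) :
    ∃ u : ℤ, ¬ (3 : ℤ) ∣ u ∧
      1 - ((companion t q) ^ n).trace + q ^ n = (1 - t + q) * u := by
  set M := companion t q with hM
  refine ⟨(∑ i ∈ range n, M ^ i).det, ?_, ?_⟩
  · let N : Matrix (Fin 2) (Fin 2) (ZMod 3) := !![0, 0; 1, 1]
    have hMN : (Int.castRingHom (ZMod 3)).mapMatrix M = N := by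
      have h1 : (q : ZMod 3) = 0 := (ZMod.intCast_zmod_eq_zero_iff_dvd q 3).2 (by exact_mod_cast hq)
      have h2 : ((1 - t : ℤ) : ZMod 3) = 0 :=
        (ZMod.intCast_zmod_eq_zero_iff_dvd _ 3).2 (by exact_mod_cast ht)
      have h3 : (t : ZMod 3) = 1 := by push_cast at h2; linear_combination -h2
      ext i j
      fin_cases i <;> fin_cases j <;> simp [hM, companion, N, h1, h3]
    have hN : ∀ k, ∑ i ∈ range (k + 1), N ^ i = !![1, 0; (k : ZMod 3), k + 1] := by
      have hpow : ∀ k, N ^ (k + 1) = N := by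
        intro k
        induction k with
        | zero => simp
        | succ k ih =>
          rw [pow_succ, ih]
          ext i j
          fin_cases i <;> fin_cases j <;> simp [N]
      intro k
      induction k with
      | zero => ext i j; fin_cases i <;> fin_cases j <;> simp
      | succ k ih =>
        rw [sum_range_succ, ih, hpow]
        ext i j
        fin_cases i <;> fin_cases j <;> simp [N]
    intro h
    have h1 := (ZMod.intCast_zmod_eq_zero_iff_dvd _ 3).2 (by exact_mod_cast h)
    obtain ⟨k, rfl⟩ := Nat.exists_eq_succ_of_ne_zero hn0
    have h2 : (Int.castRingHom (ZMod 3)) (∑ i ∈ range (k + 1), M ^ i).det = (k + 1 : ℕ) := by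
      rw [RingHom.map_det, map_sum]
      simp_rw [map_pow, hMN]
      rw [hN, Matrix.det_fin_two]
      simp
    rw [eq_intCast, h1] at h2
    have h3 := (ZMod.natCast_eq_zero_iff _ _).1 h2.symm
    have h4 := Nat.dvd_gcd h3 (dvd_refl 3)
    rw [hn] at h4
    omega
  · have h1 : (1 - M).det = 1 - t + q := by
      rw [det_one_sub_fin_two, trace_companion, det_companion]
    rw [← h1, ← Matrix.det_mul, mul_neg_geom_sum, det_one_sub_fin_two, Matrix.det_pow,
      det_companion]

/-- The comparison of the exact powers of `3`: `K + q` and `K' + q ^ n` differ by a factor prime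
to `3`, and `-q < K ≤ q` settles the cases in which adding `q` could change the valuation. -/
theorem valuation_eq_of_cofactor {m n : ℕ} (hn : 2 ≤ n) (hm : m ≠ 0) {K K' u : ℤ}
    (hu : ¬ (3 : ℤ) ∣ u) (hK : K' + (3 ^ m) ^ n = (K + 3 ^ m) * u)
    (hlow : -(3 ^ m) < K) (hup : K ≤ 3 ^ m) :
    (if K' = 0 then m * n else padicValInt 3 K') = if K = 0 then m else padicValInt 3 K := by
  have hmn : m < m * n := by nlinarith [Nat.pos_of_ne_zero hm]
  have key : ∀ (K : ℤ) (N v : ℕ), (3 : ℤ) ^ v ∣ K → ¬ (3 : ℤ) ^ (v + 1) ∣ K →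
      (if K = 0 then N else padicValInt 3 K) = v := by
    intro K N v h1 h2
    have h0 : K ≠ 0 := by rintro rfl; simp at h2
    rw [if_neg h0]
    have a1 := (padicValInt_dvd_iff (p := 3) v K).1 (by exact_mod_cast h1)
    have a2 := mt (padicValInt_dvd_iff (p := 3) (v + 1) K).2 (by exact_mod_cast h2)
    push Not at a2
    have := a1.resolve_left h0
    omega
  have hu' : ∀ v, IsCoprime ((3 : ℤ) ^ v) u := fun v =>
    ((Int.prime_three.coprime_iff_not_dvd).2 hu).pow_left
  have h3m : (0 : ℤ) < 3 ^ m := by positivity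
  -- it suffices to know the exact power `v ≤ m` of `3` in `K + 3 ^ m`
  have main : ∀ v, v ≤ m → (3 : ℤ) ^ v ∣ K + 3 ^ m → ¬ (3 : ℤ) ^ (v + 1) ∣ K + 3 ^ m →
      (if K' = 0 then m * n else padicValInt 3 K') = v := by
    intro v hv h1 h2
    have hd : (3 : ℤ) ^ (v + 1) ∣ (3 ^ m) ^ n := by
      rw [← pow_mul]; exact pow_dvd_pow _ (by omega)
    have hd' : (3 : ℤ) ^ v ∣ (3 ^ m) ^ n := (pow_dvd_pow _ (by omega)).trans hd
    refine key _ _ _ ?_ fun h => h2 ?_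
    · rw [← Int.dvd_add_left hd', hK]; exact h1.mul_right u
    · rw [← Int.dvd_add_left hd, hK] at h
      exact (hu' _).dvd_of_dvd_mul_right h
  by_cases hK0 : K = 0
  · rw [main m le_rfl (by simp [hK0]) ?_, if_pos hK0]
    rw [hK0, zero_add]
    intro h
    have := Int.le_of_dvd h3m h
    rw [pow_succ] at this; linarith
  by_cases hKq : K = 3 ^ m
  · have h2 : ¬ (3 : ℤ) ^ (m + 1) ∣ K + 3 ^ m := fun h => by
      have := Int.le_of_dvd (by linarith) h
      rw [pow_succ] at this; linarith
    have h3 : ¬ (3 : ℤ) ^ (m + 1) ∣ K := fun h => by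
      have := Int.le_of_dvd (by linarith) h
      rw [pow_succ] at this; linarith
    rw [main m le_rfl (by simp [hKq]) h2, key K m m (by simp [hKq]) h3]
  · -- here `0 < |K| < 3 ^ m`
    rw [if_neg hK0]
    have hv : ∀ j, (3 : ℤ) ^ j ∣ K ↔ j ≤ padicValInt 3 K := fun j => by
      have := padicValInt_dvd_iff (p := 3) j K
      simpa [hK0] using this
    have hlt : padicValInt 3 K < m := by
      by_contra! h
      have h1 := Int.le_of_dvd (abs_pos.2 hK0) ((dvd_abs _ _).2 ((hv m).2 h))
      have h2 : |K| < 3 ^ m := abs_lt.2 ⟨hlow, lt_of_le_of_ne hup hKq⟩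
      linarith
    refine main _ hlt.le ?_ ?_
    · exact dvd_add ((hv _).2 le_rfl) (pow_dvd_pow _ hlt.le)
    · rw [Int.dvd_add_left (pow_dvd_pow _ hlt), hv]
      omega

/-! ### Monic polynomials over a finite field -/

section Monic

variable {F : Type*} [Field F] [Finite F]

theorem finite_monic_natDegree_le (d : ℕ) : {f : F[X] | f.Monic ∧ f.natDegree ≤ d}.Finite := by
  refine Set.Finite.of_injOn (f := fun f (i : Fin (d + 1)) => f.coeff i) (t := Set.univ)
    (fun _ _ => Set.mem_univ _) ?_ Set.finite_univ
  rintro f ⟨-, hf⟩ g ⟨-, hg⟩ h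
  ext i
  by_cases hi : i ≤ d
  · exact congrFun h ⟨i, by omega⟩
  · rw [coeff_eq_zero_of_natDegree_lt (by omega), coeff_eq_zero_of_natDegree_lt (by omega)]

variable (F) in
/-- The finite set of monic polynomials of degree `d`. -/
noncomputable def monicsOfDegree (d : ℕ) : Finset F[X] :=
  Set.Finite.toFinset (s := {f : F[X] | f.Monic ∧ f.natDegree = d})
    ((finite_monic_natDegree_le d).subset fun _ hf => ⟨hf.1, hf.2.le⟩)

@[simp]
theorem mem_monicsOfDegree {d : ℕ} {f : F[X]} :
    f ∈ monicsOfDegree F d ↔ f.Monic ∧ f.natDegree = d := by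
  simp [monicsOfDegree]

variable (F) in
/-- The finite set of monic irreducible polynomials of degree at most `d`. -/
noncomputable def primesOfDegreeLE (d : ℕ) : Finset F[X] :=
  Set.Finite.toFinset (s := {f : F[X] | (f.Monic ∧ f.natDegree ≤ d) ∧ Irreducible f})
    ((finite_monic_natDegree_le d).subset fun _ hf => hf.1)

@[simp]
theorem mem_primesOfDegreeLE {d : ℕ} {f : F[X]} :
    f ∈ primesOfDegreeLE F d ↔ (f.Monic ∧ f.natDegree ≤ d) ∧ Irreducible f := by
  simp [primesOfDegreeLE]

variable (F) in
open Classical in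
/-- The monic irreducible polynomials whose degree divides `i`, for `i ≠ 0`. -/
noncomputable def primesOfDegreeDvd (i : ℕ) : Finset F[X] :=
  {P ∈ primesOfDegreeLE F i | P.natDegree ∣ i}

theorem mem_primesOfDegreeDvd {i : ℕ} (hi : i ≠ 0) {P : F[X]} :
    P ∈ primesOfDegreeDvd F i ↔ P.Monic ∧ Irreducible P ∧ P.natDegree ∣ i := by
  simp only [primesOfDegreeDvd, mem_filter, mem_primesOfDegreeLE]
  constructor
  · tauto
  · rintro ⟨h1, h2, h3⟩
    exact ⟨⟨⟨h1, Nat.le_of_dvd (Nat.pos_of_ne_zero hi) h3⟩, h2⟩, h3⟩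

open UniqueFactorizationMonoid Classical in
/-- Unique factorization, counted by degree: each `P ^ j ∣ f` with `P` prime and `j ≥ 1`
contributes `deg P`, and is recorded at `i = j * deg P`. -/
theorem sum_natDegree_of_pow_dvd {d : ℕ} {f : F[X]}
    (hf : f ∈ monicsOfDegree F d) :
    ∑ i ∈ Icc 1 d, ∑ P ∈ primesOfDegreeDvd F i with P ^ (i / P.natDegree) ∣ f, P.natDegree
      = d := by
  obtain ⟨hm, hd⟩ := mem_monicsOfDegree.1 hf
  have hf0 := hm.ne_zero
  have hsub : (normalizedFactors f).toFinset ⊆ primesOfDegreeLE F d := by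
    intro P hP
    rw [Multiset.mem_toFinset, Polynomial.mem_normalizedFactors_iff hf0] at hP
    exact mem_primesOfDegreeLE.2 ⟨⟨hP.2.1, hd ▸ natDegree_le_of_dvd hP.2.2 hf0⟩, hP.1⟩
  have hdeg : d = ∑ P ∈ primesOfDegreeLE F d, (normalizedFactors f).count P * P.natDegree := by
    have h1 := leadingCoeff_mul_prod_normalizedFactors f
    rw [hm.leadingCoeff, C_1, one_mul] at h1
    have h2 := congrArg natDegree h1
    rw [natDegree_multiset_prod _ (zero_notMem_normalizedFactors _), hd,
      sum_multiset_map_count] at h2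
    refine h2.symm.trans (sum_subset hsub fun P _ hP => ?_)
    rw [Multiset.mem_toFinset, ← Multiset.count_eq_zero] at hP
    simp [hP]
  have hswap : ∑ i ∈ Icc 1 d, ∑ P ∈ primesOfDegreeDvd F i with P ^ (i / P.natDegree) ∣ f,
      P.natDegree = ∑ P ∈ primesOfDegreeLE F d,
        ∑ i ∈ Icc 1 d with P.natDegree ∣ i ∧ P ^ (i / P.natDegree) ∣ f, P.natDegree := by
    refine sum_comm' fun i P => ?_
    by_cases hi : i = 0
    · simp [hi]
    simp only [mem_filter, mem_Icc, mem_primesOfDegreeDvd hi, mem_primesOfDegreeLE]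
    constructor
    · rintro ⟨h1, ⟨h2, h3, h4⟩, h5⟩
      exact ⟨⟨h1, h4, h5⟩,
        ⟨h2, (Nat.le_of_dvd (Nat.pos_of_ne_zero hi) h4).trans h1.2⟩, h3⟩
    · rintro ⟨⟨h1, h4, h5⟩, ⟨h2, -⟩, h3⟩
      exact ⟨h1, ⟨h2, h3, h4⟩, h5⟩
  rw [hswap]
  conv_rhs => rw [hdeg]
  refine sum_congr rfl fun P hP => ?_
  obtain ⟨⟨hPm, -⟩, hPi⟩ := mem_primesOfDegreeLE.1 hP
  have hpos := hPi.natDegree_pos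
  have hdvd : ∀ j, P ^ j ∣ f ↔ j ≤ (normalizedFactors f).count P := fun j => by
    rw [pow_dvd_iff_le_emultiplicity, emultiplicity_eq_count_normalizedFactors hPi hf0,
      hPm.normalize_eq_self]
    exact_mod_cast Iff.rfl
  rw [sum_const, smul_eq_mul]
  congr 1
  -- the exponents `i` recorded for `P` are `j * deg P` with `1 ≤ j ≤ count P`
  have himg : {i ∈ Icc 1 d | P.natDegree ∣ i ∧ P ^ (i / P.natDegree) ∣ f} =
      (Icc 1 ((normalizedFactors f).count P)).image (· * P.natDegree) := by
    ext i
    simp only [mem_filter, mem_Icc, mem_image, hdvd]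
    constructor
    · rintro ⟨⟨h1, -⟩, h2, h3⟩
      exact ⟨i / P.natDegree,
        ⟨Nat.div_pos (Nat.le_of_dvd h1 h2) hpos, h3⟩, Nat.div_mul_cancel h2⟩
    · rintro ⟨j, ⟨h1, h2⟩, rfl⟩
      have h3 := natDegree_le_of_dvd ((hdvd j).2 h2) hf0
      rw [hPm.natDegree_pow, hd] at h3
      rw [Nat.mul_div_cancel _ hpos]
      exact ⟨⟨Nat.mul_pos h1 hpos, h3⟩, dvd_mul_left _ _, h2⟩
  rw [himg, card_image_of_injective _ fun _ _ h => Nat.eq_of_mul_eq_mul_right hpos h]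
  simp

open Classical in
theorem sum_monicsOfDegree_filter_dvd {M : Type*} [AddCommMonoid M] {d e : ℕ} {Q : F[X]}
    (hQ : Q.Monic) (he : Q.natDegree = e) (hed : e ≤ d) (φ : F[X] → M) :
    ∑ f ∈ monicsOfDegree F d with Q ∣ f, φ f = ∑ g ∈ monicsOfDegree F (d - e), φ (Q * g) := by
  symm
  refine sum_bij (fun g _ => Q * g) ?_ ?_ ?_ fun _ _ => rfl
  · intro g hg
    obtain ⟨h1, h2⟩ := mem_monicsOfDegree.1 hg
    rw [mem_filter, mem_monicsOfDegree, hQ.natDegree_mul h1]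
    exact ⟨⟨hQ.mul h1, by omega⟩, dvd_mul_right _ _⟩
  · intro g _ g' _ h
    exact mul_left_cancel₀ hQ.ne_zero h
  · intro f hf
    rw [mem_filter, mem_monicsOfDegree] at hf
    obtain ⟨⟨h1, h2⟩, g, rfl⟩ := hf
    have hg := hQ.of_mul_monic_left h1
    rw [hQ.natDegree_mul hg] at h2
    exact ⟨g, mem_monicsOfDegree.2 ⟨hg, by omega⟩, rfl⟩

variable {R : Type*} [CommRing R]

/-- For `i ≠ 0`, the coefficient of `T ^ i` in `T * Z' / Z`, where `Z` is the Euler product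
`∏ (1 - lam P * T ^ deg P)⁻¹` over the prime polynomials `P`. -/
noncomputable def primePowerSum (lam : F[X] → R) (i : ℕ) : R :=
  ∑ P ∈ primesOfDegreeDvd F i, P.natDegree * lam P ^ (i / P.natDegree)

/-- The logarithmic derivative of the Euler product of a completely multiplicative `lam`, as an
identity between coefficients. -/
theorem natCast_mul_sum_monics (lam : F[X] → R) (h1 : lam 1 = 1)
    (hmul : ∀ f g : F[X], f.Monic → g.Monic → lam (f * g) = lam f * lam g) (d : ℕ) :
    d * ∑ f ∈ monicsOfDegree F d, lam f =
      ∑ i ∈ Icc 1 d, primePowerSum lam i * ∑ f ∈ monicsOfDegree F (d - i), lam f := by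
  classical
  have hpow : ∀ P : F[X], P.Monic → ∀ j, lam (P ^ j) = lam P ^ j := by
    intro P hP j
    induction j with
    | zero => simp [h1]
    | succ j ih => rw [pow_succ, hmul _ _ (hP.pow j) hP, ih, pow_succ]
  calc d * ∑ f ∈ monicsOfDegree F d, lam f
      = ∑ f ∈ monicsOfDegree F d, ∑ i ∈ Icc 1 d,
          ∑ P ∈ primesOfDegreeDvd F i with P ^ (i / P.natDegree) ∣ f, P.natDegree * lam f := by
        rw [mul_sum]
        refine sum_congr rfl fun f hf => ?_
        simp_rw [← sum_mul]
        congr 1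
        conv_lhs => rw [← sum_natDegree_of_pow_dvd hf]
        push_cast
        rfl
    _ = ∑ i ∈ Icc 1 d, ∑ P ∈ primesOfDegreeDvd F i,
          ∑ f ∈ monicsOfDegree F d with P ^ (i / P.natDegree) ∣ f, P.natDegree * lam f := by
        rw [sum_comm]
        refine sum_congr rfl fun i _ => sum_comm' fun f P => ?_
        simp only [mem_filter]
        tauto
    _ = _ := by
        refine sum_congr rfl fun i hi => ?_
        rw [mem_Icc] at hi
        rw [primePowerSum, sum_mul]
        refine sum_congr rfl fun P hP => ?_
        obtain ⟨hPm, -, hPd⟩ := (mem_primesOfDegreeDvd (by omega)).1 hP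
        rw [sum_monicsOfDegree_filter_dvd (hPm.pow _)
          (by rw [hPm.natDegree_pow, Nat.div_mul_cancel hPd]) hi.2, mul_assoc, mul_sum, mul_sum]
        refine sum_congr rfl fun g hg => ?_
        rw [hmul _ _ (hPm.pow _) (mem_monicsOfDegree.1 hg).1, hpow P hPm]

end Monic

/-! ### The `L`-function of the Kloosterman sum -/

section LFunction

variable {F : Type*} [Field F] {R : Type*} [CommRing R]

open Classical in
/-- The completely multiplicative function on monic polynomials attached to the Kloosterman sum
with parameter `a`: if `f` has the nonzero roots `r`, its value is `ψ (∑ r + a * ∑ r⁻¹)`, and it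
vanishes if `0` is a root of `f`. -/
noncomputable def kloostermanWeight (ψ : AddChar F R) (a : F) (f : F[X]) : R :=
  if f.coeff 0 = 0 then 0 else ψ (-(f.nextCoeff + a * (f.coeff 1 / f.coeff 0)))

variable (ψ : AddChar F R) (a : F)

theorem kloostermanWeight_of_coeff_zero_eq_zero {f : F[X]} (hf : f.coeff 0 = 0) :
    kloostermanWeight ψ a f = 0 := if_pos hf

theorem kloostermanWeight_of_coeff_zero_ne_zero {f : F[X]} (hf : f.coeff 0 ≠ 0) :
    kloostermanWeight ψ a f = ψ (-(f.nextCoeff + a * (f.coeff 1 / f.coeff 0))) := if_neg hf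

theorem kloostermanWeight_one : kloostermanWeight ψ a 1 = 1 := by
  rw [kloostermanWeight_of_coeff_zero_ne_zero _ _ (by simp)]
  simp [nextCoeff, coeff_one]

theorem kloostermanWeight_mul {f g : F[X]} (hf : f.Monic) (hg : g.Monic) :
    kloostermanWeight ψ a (f * g) = kloostermanWeight ψ a f * kloostermanWeight ψ a g := by
  by_cases h1 : f.coeff 0 = 0
  · rw [kloostermanWeight_of_coeff_zero_eq_zero _ _ h1,
      kloostermanWeight_of_coeff_zero_eq_zero _ _ (by simp [mul_coeff_zero, h1]), zero_mul]
  by_cases h2 : g.coeff 0 = 0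
  · rw [kloostermanWeight_of_coeff_zero_eq_zero _ _ h2,
      kloostermanWeight_of_coeff_zero_eq_zero _ _ (by simp [mul_coeff_zero, h2]), mul_zero]
  rw [kloostermanWeight_of_coeff_zero_ne_zero _ _ h1,
    kloostermanWeight_of_coeff_zero_ne_zero _ _ h2,
    kloostermanWeight_of_coeff_zero_ne_zero _ _ (by simp [mul_coeff_zero, h1, h2]),
    ← AddChar.map_add_eq_mul, hf.nextCoeff_mul hg, mul_coeff_one, mul_coeff_zero]
  congr 1
  field_simp
  ring

variable [Fintype F]

theorem sum_kloostermanWeight_zero :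
    ∑ f ∈ monicsOfDegree F 0, kloostermanWeight ψ a f = 1 := by
  have : monicsOfDegree F 0 = {1} := by
    ext f
    rw [mem_monicsOfDegree, mem_singleton]
    exact ⟨fun h => h.1.natDegree_eq_zero.1 h.2, by rintro rfl; simp⟩
  rw [this, sum_singleton, kloostermanWeight_one]

open Classical in
theorem sum_kloostermanWeight_one :
    ∑ f ∈ monicsOfDegree F 1, kloostermanWeight ψ a f = ∑ x : F with x ≠ 0, ψ (x + a / x) := by
  symm
  rw [sum_filter]
  refine sum_bij (fun x _ => X - C x) (fun x _ => ?_) (fun x _ y _ h => ?_) (fun f hf => ?_)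
    fun x _ => ?_
  · exact mem_monicsOfDegree.2 ⟨monic_X_sub_C x, natDegree_X_sub_C x⟩
  · simpa using h
  · obtain ⟨h1, h2⟩ := mem_monicsOfDegree.1 hf
    refine ⟨-f.coeff 0, mem_univ _, ?_⟩
    conv_rhs => rw [h1.eq_X_add_C h2]
    simp
  · by_cases hx : x = 0
    · rw [kloostermanWeight_of_coeff_zero_eq_zero _ _ (by simp [hx]), if_neg (by simp [hx])]
    · rw [kloostermanWeight_of_coeff_zero_ne_zero _ _ (by simpa using hx), if_pos hx,
        nextCoeff_X_sub_C]
      congr 1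
      simp [coeff_X, coeff_C]
      field_simp
      ring

theorem sum_kloostermanWeight_two [IsDomain R] (hψ : ψ ≠ 1) (ha : a ≠ 0) :
    ∑ f ∈ monicsOfDegree F 2, kloostermanWeight ψ a f = Fintype.card F := by
  classical
  have h : ∑ f ∈ monicsOfDegree F 2, kloostermanWeight ψ a f =
      ∑ p : F × F, kloostermanWeight ψ a (X ^ 2 + C p.2 * X + C p.1) := by
    symm
    refine sum_bij (fun p _ => X ^ 2 + C p.2 * X + C p.1) (fun p _ => ?_) (fun p _ p' _ h => ?_)
      (fun f hf => ?_) fun p _ => rfl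
    · rw [mem_monicsOfDegree]
      exact ⟨by monicity!, by compute_degree!⟩
    · have h0 := congrArg (fun f => coeff f 0) h
      have h1 := congrArg (fun f => coeff f 1) h
      simp [coeff_C] at h0 h1
      exact Prod.ext h0 h1
    · obtain ⟨h1, h2⟩ := mem_monicsOfDegree.1 hf
      refine ⟨(f.coeff 0, f.coeff 1), mem_univ _, ?_⟩
      conv_rhs => rw [h1.as_sum, h2]
      simp [sum_range_succ]
      ring
  have hw : ∀ b c : F, kloostermanWeight ψ a (X ^ 2 + C b * X + C c) =
      if c = 0 then 0 else ψ (b * -(1 + a / c)) := by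
    intro b c
    have h0 : (X ^ 2 + C b * X + C c : F[X]).coeff 0 = c := by simp
    have h1 : (X ^ 2 + C b * X + C c : F[X]).coeff 1 = b := by simp [coeff_C]
    have hd : (X ^ 2 + C b * X + C c : F[X]).natDegree = 2 := by compute_degree!
    rw [kloostermanWeight, h0]
    refine ite_congr rfl (fun _ => rfl) fun hc => ?_
    rw [nextCoeff_of_natDegree_pos (by omega), hd, h1]
    congr 1
    ring
  rw [h, Fintype.sum_prod_type]
  simp only [hw]
  have hpsi : ψ.IsPrimitive := AddChar.IsPrimitive.of_ne_one hψ
  -- the sum over the linear coefficient singles out the constant coefficient `-a`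
  rw [sum_eq_single (-a)]
  · simp [ha]
  · intro c _ hc
    by_cases hc0 : c = 0
    · simp [hc0]
    simp only [if_neg hc0]
    rw [AddChar.sum_mulShift _ hpsi, if_neg, Nat.cast_zero]
    intro h
    apply hc
    field_simp at h
    linear_combination -h
  · simp

/-- In degree at least three the coefficients of degree `d - 1` and `1` are independent, so the
sum is invariant under multiplication by every value of `ψ`. -/
theorem sum_kloostermanWeight_of_three_le [IsDomain R] (hψ : ψ ≠ 1) {d : ℕ} (hd : 3 ≤ d) :
    ∑ f ∈ monicsOfDegree F d, kloostermanWeight ψ a f = 0 := by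
  obtain ⟨c, hc⟩ := AddChar.ne_one_iff.1 hψ
  have hmem : ∀ b : F, ∀ f ∈ monicsOfDegree F d, f + C b * X ^ (d - 1) ∈ monicsOfDegree F d := by
    intro b f hf
    obtain ⟨h1, h2⟩ := mem_monicsOfDegree.1 hf
    have hlt : (C b * X ^ (d - 1)).degree < f.degree := by
      rw [degree_eq_natDegree h1.ne_zero, h2]
      refine (degree_C_mul_X_pow_le _ _).trans_lt ?_
      exact_mod_cast (by omega : d - 1 < d)
    exact mem_monicsOfDegree.2 ⟨h1.add_of_left hlt, by
      rw [natDegree_add_eq_left_of_degree_lt hlt, h2]⟩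
  have h : ∑ f ∈ monicsOfDegree F d, kloostermanWeight ψ a f =
      ∑ f ∈ monicsOfDegree F d, ψ c * kloostermanWeight ψ a f := by
    symm
    refine sum_bij (fun f _ => f + C (-c) * X ^ (d - 1)) (fun f hf => hmem _ f hf)
      (fun f _ g _ h => add_right_cancel h)
      (fun f hf => ⟨f + C c * X ^ (d - 1), hmem _ f hf, by simp⟩) fun f hf => ?_
    have h2 := (mem_monicsOfDegree.1 hf).2
    have h3 := (mem_monicsOfDegree.1 (hmem (-c) f hf)).2
    have hc0 : (f + C (-c) * X ^ (d - 1)).coeff 0 = f.coeff 0 := by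
      rw [coeff_add, coeff_C_mul_X_pow, if_neg (by omega), add_zero]
    have hc1 : (f + C (-c) * X ^ (d - 1)).coeff 1 = f.coeff 1 := by
      rw [coeff_add, coeff_C_mul_X_pow, if_neg (by omega), add_zero]
    have hn : (f + C (-c) * X ^ (d - 1)).nextCoeff = f.nextCoeff - c := by
      rw [nextCoeff_of_natDegree_pos (by omega), nextCoeff_of_natDegree_pos (by omega), h2, h3,
        coeff_add, coeff_C_mul_X_pow, if_pos rfl, sub_eq_add_neg]
    by_cases hf0 : f.coeff 0 = 0
    · rw [kloostermanWeight_of_coeff_zero_eq_zero _ _ hf0,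
        kloostermanWeight_of_coeff_zero_eq_zero _ _ (hc0.trans hf0), mul_zero]
    · rw [kloostermanWeight_of_coeff_zero_ne_zero _ _ hf0,
        kloostermanWeight_of_coeff_zero_ne_zero _ _ (hc0.trans_ne hf0), hc0, hc1, hn,
        ← AddChar.map_add_eq_mul]
      congr 1
      ring
  rw [← mul_sum] at h
  have h' : (1 - ψ c) * ∑ f ∈ monicsOfDegree F d, kloostermanWeight ψ a f = 0 := by
    rw [sub_mul, one_mul, ← h, sub_self]
  exact (mul_eq_zero.1 h').resolve_left (sub_ne_zero.2 hc.symm)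

/-- The `L`-function `1 + k T + q T ^ 2` is a polynomial, so that the prime power sums, which
are the negated power sums of its reciprocal roots, satisfy a linear recurrence. -/
theorem primePowerSum_kloostermanWeight [IsDomain R] (hψ : ψ ≠ 1) (ha : a ≠ 0) :
    let A := primePowerSum (kloostermanWeight ψ a)
    let k := ∑ f ∈ monicsOfDegree F 1, kloostermanWeight ψ a f
    A 1 = k ∧ A 2 = 2 * Fintype.card F - k ^ 2 ∧
      ∀ n, A (n + 3) = -k * A (n + 2) - Fintype.card F * A (n + 1) := by
  intro A k
  have key := natCast_mul_sum_monics (kloostermanWeight ψ a) (kloostermanWeight_one ψ a)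
    fun f g => kloostermanWeight_mul ψ a
  have h1 : A 1 = k := by
    have := key 1
    simpa [sum_kloostermanWeight_zero] using this.symm
  refine ⟨h1, ?_, fun n => ?_⟩
  · have := key 2
    simp only [show Icc 1 2 = {1, 2} from rfl, sum_kloostermanWeight_two ψ a hψ ha,
      sum_pair (show 1 ≠ 2 by norm_num), Nat.sub_self, sum_kloostermanWeight_zero,
      show 2 - 1 = 1 from rfl] at this
    change ((2 : ℕ) : R) * _ = A 1 * k + A 2 * 1 at this
    push_cast at this
    rw [h1] at this
    linear_combination -this
  · have := key (n + 3)
    rw [sum_kloostermanWeight_of_three_le ψ a hψ (by omega), mul_zero,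
      sum_Icc_succ_top (by omega), sum_Icc_succ_top (by omega), sum_Icc_succ_top (by omega),
      sum_eq_zero, Nat.sub_self, sum_kloostermanWeight_zero,
      show n + 3 - (n + 2) = 1 by omega, show n + 3 - (n + 1) = 2 by omega,
      sum_kloostermanWeight_two ψ a hψ ha] at this
    · change 0 = 0 + A (n + 1) * _ + A (n + 2) * k + A (n + 3) * 1 at this
      linear_combination -this
    · intro i hi
      rw [mem_Icc] at hi
      rw [sum_kloostermanWeight_of_three_le ψ a hψ (by omega), mul_zero]

end LFunction

/-! ### Kloosterman sums over an extension as power sums -/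

section Extension

open IntermediateField Module

theorem adjoin_simple_inv (F : Type*) {L : Type*} [Field F] [Field L] [Algebra F L] (x : L) :
    F⟮x⁻¹⟯ = F⟮x⟯ := by
  refine le_antisymm (adjoin_simple_le_iff.2 (inv_mem (mem_adjoin_simple_self F x)))
    (adjoin_simple_le_iff.2 ?_)
  simpa using inv_mem (mem_adjoin_simple_self F x⁻¹)

/-- The minimal polynomial of `x⁻¹` is the monic reversal of the minimal polynomial of `x`. -/
theorem minpoly_inv {F L : Type*} [Field F] [Field L] [Algebra F L] {x : L}
    (hx : IsIntegral F x) (hx0 : x ≠ 0) :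
    minpoly F x⁻¹ = C ((minpoly F x).coeff 0)⁻¹ * (minpoly F x).reverse := by
  have h0 : (minpoly F x).coeff 0 ≠ 0 := minpoly.coeff_zero_ne_zero hx hx0
  have hx' : IsIntegral F x⁻¹ := hx.inv
  have htr : (minpoly F x).natTrailingDegree = 0 := natTrailingDegree_eq_zero.2 (Or.inr h0)
  have hlc : (minpoly F x).reverse.leadingCoeff = (minpoly F x).coeff 0 := by
    rw [reverse_leadingCoeff, trailingCoeff, htr]
  refine (eq_of_monic_of_dvd_of_natDegree_le (minpoly.monic hx') ?_ (minpoly.dvd F _ ?_) ?_).symm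
  · rw [Monic, leadingCoeff_mul, leadingCoeff_C, hlc, inv_mul_cancel₀ h0]
  · let _ := invertibleOfNonzero hx0
    have := (eval₂_reverse_eq_zero_iff (algebraMap F L) x (minpoly F x)).2 (minpoly.aeval F x)
    rw [invOf_eq_inv] at this
    rw [map_mul, aeval_def (x⁻¹) (minpoly F x).reverse, this, mul_zero]
  · rw [natDegree_C_mul (inv_ne_zero h0), reverse_natDegree, htr, Nat.sub_zero,
      ← adjoin.finrank hx, ← adjoin.finrank hx', adjoin_simple_inv]

theorem nextCoeff_minpoly_inv {F L : Type*} [Field F] [Field L] [Algebra F L] {x : L}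
    (hx : IsIntegral F x) (hx0 : x ≠ 0) :
    (minpoly F x⁻¹).nextCoeff = (minpoly F x).coeff 1 / (minpoly F x).coeff 0 := by
  have h0 : (minpoly F x).coeff 0 ≠ 0 := minpoly.coeff_zero_ne_zero hx hx0
  have hpos := minpoly.natDegree_pos hx
  have hd : (minpoly F x⁻¹).natDegree = (minpoly F x).natDegree := by
    rw [← adjoin.finrank hx, ← adjoin.finrank hx.inv, adjoin_simple_inv]
  rw [nextCoeff_of_natDegree_pos (hd ▸ hpos), hd, minpoly_inv hx hx0, coeff_C_mul, coeff_reverse,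
    revAt_le (by omega), Nat.sub_sub_self hpos, div_eq_inv_mul]

variable {F L : Type*} [Field F] [Field L] [Fintype L] [Algebra F L]

open Classical in
/-- The roots in `L` of a prime polynomial whose degree divides `[L : F]` are distinct, and there
are as many of them as its degree. -/
theorem card_minpoly_eq [Finite F] {P : F[X]} (hm : P.Monic)
    (hi : Irreducible P) (hd : P.natDegree ∣ finrank F L) :
    #{x : L | minpoly F x = P} = P.natDegree := by
  have hdvd := hi.natDegree_dvd_iff_dvd_X_pow_card_pow_sub_X.1 hd
  rw [← Module.natCard_eq_pow_finrank (K := F) (V := L), Nat.card_eq_fintype_card] at hdvd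
  have h0 : (X ^ Fintype.card L - X : F[X]).map (algebraMap F L) ≠ 0 :=
    Polynomial.map_ne_zero (FiniteField.X_pow_card_sub_X_ne_zero F Fintype.one_lt_card)
  have hsplit : (P.map (algebraMap F L)).Splits :=
    (IsSplittingField.splits L (X ^ Fintype.card L - X : F[X])).of_dvd h0
      (Polynomial.map_dvd (algebraMap F L) hdvd)
  have hnodup := nodup_roots ((PerfectField.separable_of_irreducible hi).map (f := algebraMap F L))
  have hset : ({x : L | minpoly F x = P} : Finset L) = (P.map (algebraMap F L)).roots.toFinset := by
    ext x
    rw [mem_filter, Multiset.mem_toFinset, mem_roots_map hm.ne_zero, ← aeval_def]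
    constructor
    · rintro ⟨-, rfl⟩
      exact minpoly.aeval F x
    · exact fun h => ⟨mem_univ _, (minpoly.eq_of_irreducible_of_monic hi h hm).symm⟩
  rw [hset, Multiset.toFinset_card_of_nodup hnodup, ← hsplit.natDegree_eq_card_roots,
    natDegree_map]

/-- Prime power sums at `[L : F]` are sums over `L`, grouped by minimal polynomial. -/
theorem primePowerSum_finrank [Finite F] {R : Type*} [CommRing R] (lam : F[X] → R) :
    primePowerSum lam (finrank F L) =
      ∑ x : L, lam (minpoly F x) ^ (finrank F L / (minpoly F x).natDegree) := by
  classical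
  have hmem : ∀ x : L, minpoly F x ∈ primesOfDegreeDvd F (finrank F L) := fun x =>
    (mem_primesOfDegreeDvd finrank_pos.ne').2
      ⟨minpoly.monic (.of_finite F x), minpoly.irreducible (.of_finite F x),
        minpoly.degree_dvd (.of_finite F x)⟩
  rw [← sum_fiberwise_of_maps_to (fun x _ => hmem x), primePowerSum]
  refine sum_congr rfl fun P hP => ?_
  obtain ⟨h1, h2, h3⟩ := (mem_primesOfDegreeDvd finrank_pos.ne').1 hP
  rw [sum_congr rfl (g := fun _ => lam P ^ (finrank F L / P.natDegree)) fun x hx => by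
      rw [(mem_filter.1 hx).2], sum_const, card_minpoly_eq h1 h2 h3, nsmul_eq_mul]

theorem kloostermanWeight_minpoly_pow [Finite F] {R : Type*} [CommRing R] (ψ : AddChar F R) (a : F)
    {x : L} (hx0 : x ≠ 0) :
    kloostermanWeight ψ a (minpoly F x) ^ (finrank F L / (minpoly F x).natDegree) =
      ψ (Algebra.trace F L (x + algebraMap F L a / x)) := by
  have hx : IsIntegral F x := .of_finite F x
  have hdiv : finrank F L / (minpoly F x).natDegree = finrank F⟮x⟯ L := by
    rw [← adjoin.finrank hx, ← finrank_mul_finrank F F⟮x⟯ L, Nat.mul_div_cancel_left _ finrank_pos]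
  rw [kloostermanWeight_of_coeff_zero_ne_zero _ _ (minpoly.coeff_zero_ne_zero hx hx0), hdiv,
    ← AddChar.map_nsmul_eq_pow, div_eq_mul_inv (algebraMap F L a), ← Algebra.smul_def, map_add,
    (Algebra.trace F L).map_smul, trace_eq_finrank_mul_minpoly_nextCoeff F x,
    trace_eq_finrank_mul_minpoly_nextCoeff F x⁻¹, adjoin_simple_inv,
    nextCoeff_minpoly_inv hx hx0, nsmul_eq_mul, smul_eq_mul]
  congr 1
  ring

open Classical in
theorem primePowerSum_kloostermanWeight_finrank [Finite F] {R : Type*} [CommRing R]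
    (ψ : AddChar F R) (a : F) :
    primePowerSum (kloostermanWeight ψ a) (finrank F L) =
      ∑ x : L with x ≠ 0, ψ (Algebra.trace F L (x + algebraMap F L a / x)) := by
  rw [primePowerSum_finrank, sum_filter]
  refine sum_congr rfl fun x _ => ?_
  split_ifs with hx
  · exact kloostermanWeight_minpoly_pow ψ a hx
  · obtain rfl : x = 0 := not_not.1 hx
    rw [kloostermanWeight_of_coeff_zero_eq_zero _ _ (by simp), minpoly.zero, natDegree_X,
      Nat.div_one, zero_pow finrank_pos.ne']

end Extension

/-! ### The ternary case -/

section Ternary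

open Module

theorem omega_pow_three : omega ^ 3 = 1 := by
  linear_combination (omega - 1) * one_add_omega_add_sq

variable (F : Type*) [Field F] [Algebra (ZMod 3) F]

/-- The canonical additive character `x ↦ ω ^ Tr x`, bundled. -/
noncomputable def eChar : AddChar F ℂ :=
  (AddChar.zmodChar 3 omega_pow_three).compAddMonoidHom (Algebra.trace (ZMod 3) F).toAddMonoidHom

theorem eChar_apply (x : F) : eChar F x = e F x := rfl

variable [Fintype F]

theorem eChar_ne_one : eChar F ≠ 1 := by
  intro h
  refine Algebra.trace_ne_zero (ZMod 3) F (LinearMap.ext fun x => ?_)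
  have hprim : IsPrimitiveRoot omega 3 := by
    simpa [omega] using Complex.isPrimitiveRoot_exp 3 (by norm_num)
  have hx : omega ^ (Algebra.trace (ZMod 3) F x).val = 1 := DFunLike.congr_fun h x
  rw [hprim.pow_eq_one_iff_dvd] at hx
  exact (ZMod.val_eq_zero _).1 (Nat.eq_zero_of_dvd_of_lt hx (ZMod.val_lt _))

variable {F}

/-- Pairing `x` with `-x`: here `N` is the number of `x` with `Tr (x + a / x) = 0`, among which is
`x = 0`. -/
theorem two_mul_kloosterman (a : F) : ∃ N : ℕ, 1 ≤ N ∧ N ≤ Fintype.card F ∧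
    2 * kloosterman F a = 3 * N - Fintype.card F := by
  classical
  let τ : F → ZMod 3 := fun x => Algebra.trace (ZMod 3) F (x + a / x)
  have hτ : ∀ x, τ (-x) = -τ x := fun x => by
    simp only [τ]
    rw [div_neg, ← neg_add, map_neg]
  have hsum : ∀ t : ZMod 3, omegaPow t + omegaPow (-t) = 3 * (if t = 0 then 1 else 0) - 1 := by
    intro t
    have h := one_add_omega_add_sq
    have ht : t = 0 ∨ t = 1 ∨ t = 2 := by revert t; decide
    have h1 : (1 : ZMod 3).val = 1 := rfl
    have h2 : (2 : ZMod 3).val = 2 := rfl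
    rcases ht with rfl | rfl | rfl
    · norm_num [omegaPow]
    · rw [show -(1 : ZMod 3) = 2 by decide, if_neg (by decide), omegaPow, omegaPow, h1, h2]
      linear_combination h
    · rw [show -(2 : ZMod 3) = 1 by decide, if_neg (by decide), omegaPow, omegaPow, h1, h2]
      linear_combination h
  refine ⟨#{x | τ x = 0}, card_pos.2 ⟨0, by simp [τ]⟩, card_le_univ _, ?_⟩
  have hK : kloosterman F a = ∑ x, omegaPow (τ x) := rfl
  have hK' : kloosterman F a = ∑ x, omegaPow (-τ x) := by
    rw [hK, ← Equiv.sum_comp (Equiv.neg F)]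
    simp [hτ]
  rw [two_mul]
  nth_rewrite 1 [hK]
  rw [hK', ← sum_add_distrib]
  simp_rw [hsum]
  rw [sum_sub_distrib, ← mul_sum]
  simp

end Ternary

end TernaryKloosterman

theorem proposition2 {F L : Type*} [Field F] [Fintype F] [Algebra (ZMod 3) F]
    [Field L] [Fintype L] [Algebra F L] (n : ℕ) (hn : Module.finrank F L = n)
    (hn3 : Nat.Coprime n 3) (a : F) (ha : a ≠ 0) :
    TernaryKloosterman.HExt F L a = TernaryKloosterman.H F a := by
  open TernaryKloosterman in
  classical
  obtain ⟨K, hK⟩ := kloosterman_isInt F a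
  obtain ⟨K', hK'⟩ := kloostermanExt_isInt F L a
  obtain ⟨N, hN1, hNq, hN⟩ := two_mul_kloosterman a
  set m := Module.finrank (ZMod 3) F with hm
  have hq : Fintype.card F = 3 ^ m := by
    rw [Module.card_eq_pow_finrank (K := ZMod 3) (V := F), ZMod.card]
  have hm0 : m ≠ 0 := Module.finrank_pos.ne'
  have hN' : 2 * K = 3 * N - 3 ^ m := by
    rw [hK, hq] at hN
    exact_mod_cast hN
  rw [HExt, H, hK, hK', hn, maxDegThree_intCast, maxDegThree_intCast]
  have hA := primePowerSum_kloostermanWeight (eChar F) a (eChar_ne_one F) ha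
  have hAn := primePowerSum_kloostermanWeight_finrank (L := L) (eChar F) a
  rw [hn] at hAn
  set A := primePowerSum (kloostermanWeight (eChar F) a) with hAdef
  have hn0 : n ≠ 0 := hn ▸ Module.finrank_pos.ne'
  have hk : ∑ f ∈ monicsOfDegree F 1, kloostermanWeight (eChar F) a f = ((K - 1 : ℤ) : ℂ) := by
    rw [sum_kloostermanWeight_one, Finset.filter_ne', Int.cast_sub, ← hK, kloosterman,
      ← Finset.add_sum_erase _ _ (Finset.mem_univ (0 : F))]
    simp [eChar_apply, e, omegaPow]
  have hk' : A n = ((K' - 1 : ℤ) : ℂ) := by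
    rw [hAn, Finset.filter_ne', Int.cast_sub, ← hK', kloostermanExt,
      ← Finset.add_sum_erase _ _ (Finset.mem_univ (0 : L))]
    simp [eChar_apply, e, eExt, omegaPow]
  obtain ⟨h1, h2, h3⟩ := hA
  rw [hk] at h1 h2 h3
  -- for `n = 1` the valuation of `K + q` does not determine that of `K_n`
  rcases eq_or_ne n 1 with rfl | hn1
  · have : K' = K := by
      rw [hk'] at h1
      have : K' - 1 = K - 1 := by exact_mod_cast h1
      omega
    rw [this, mul_one]
  have hq' : (Fintype.card F : ℂ) = ((3 ^ m : ℤ) : ℂ) := by rw [hq]; push_cast; rfl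
  rw [hq'] at h2 h3
  have h3q : (3 : ℤ) ∣ 3 ^ m := dvd_pow_self 3 hm0
  -- the power sums `-A i` and the traces of the powers satisfy the same recurrence
  have htr : ∀ i, A (i + 1) = ((-((companion (1 - K) (3 ^ m)) ^ (i + 1)).trace : ℤ) : ℂ) ∧
      A (i + 2) = ((-((companion (1 - K) (3 ^ m)) ^ (i + 2)).trace : ℤ) : ℂ) := by
    intro i
    induction i with
    | zero =>
      constructor
      · rw [zero_add, h1, pow_one, trace_companion]
        push_cast
        ring
      · rw [h2, trace_pow_add_two, trace_companion, det_companion, zero_add, pow_one,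
          trace_companion, pow_zero, Matrix.trace_one]
        push_cast [Fintype.card_fin]
        ring
    | succ i ih =>
      refine ⟨ih.2, ?_⟩
      rw [h3, ih.1, ih.2, trace_pow_add_two _ (i + 1), trace_companion, det_companion]
      push_cast
      ring
  have hK1 : 1 - ((companion (1 - K) (3 ^ m)) ^ n).trace = K' := by
    obtain ⟨i, rfl⟩ := Nat.exists_eq_succ_of_ne_zero hn0
    have h := hk'.symm.trans (htr i).1
    have h' : K' - 1 = -((companion (1 - K) (3 ^ m)) ^ (i + 1)).trace := by exact_mod_cast h
    rw [Nat.succ_eq_add_one]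
    linarith
  have h3K : (3 : ℤ) ∣ 1 - (1 - K) := by omega
  obtain ⟨u, hu, hcof⟩ := exists_cofactor h3q h3K hn0 hn3
  rw [hK1, sub_sub_cancel] at hcof
  have hN1' : (1 : ℤ) ≤ N := by exact_mod_cast hN1
  have hNq' : (N : ℤ) ≤ 3 ^ m := by rw [hq] at hNq; exact_mod_cast hNq
  exact valuation_eq_of_cofactor (by omega) hm0 hu hcof
    (by linarith [pow_pos (by norm_num : (0 : ℤ) < 3) m]) (by linarith)
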